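/- Let $A$ be a finite set, $p\ge 2$, and let $\tau:A\to A^p$ be a substitution of constant length $p$, extended by concatenation to finite words and to $A^{\mathbb Z}$ (so that $\tau(x)=\dots\tau(x_{-1}).\tau(x_0)\tau(x_1)\dots$). Assume that $\tau$ is one-to-one ($\tau(a)\ne\tau(b)$ for letters $a\neq b$) and primitive (for some $n$, every letter occurs in $\tau^n(b)$ for every letter $b$). Let $T$ be the shift $(Tx)_i=x_{i+1}$ on $A^{\mathbb Z}$, and let $X_\tau\subseteq A^{\mathbb Z}$ be the substitution subshift, i.e. the set of sequences all of whose finite sub-words occur in some $\tau^n(a)$, $n\ge 0$, $a\in A$. Assume that $X_\tau$ is infinite. Let $\varrho(x,y)=2^{-\min\{|i|:x_i\ne y_i\}}$ for $x\neq y$ and $\varrho(x,x)=0$ (any metric compatible with the topology of $X_\tau$ gives the same notions below). A pair $(x,y)\in X_\tau^2$ is distal if $\liminf_{n\to\infty}\varrho(T^nx,T^ny)>0$, proximal if this $\liminf$ is $0$, asymptotic if $\lim_{n\to\infty}\varrho(T^nx,T^ny)=0$, and a Li–Yorke pair if it is proximal but not asymptotic. For every $x\in X_\tau$ there are unique sequences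 $(x^{(i)})_{i\ge0}$ in $X_\tau$ and $(\delta_i)_{i\ge 0}$ in $\{0,\dots,p-1\}$ with $x^{(0)}=x$ and $\tau(x^{(i+1)})=T^{-\delta_i}(x^{(i)})$ for all $i\ge 0$. Put $\pi(x)=(\delta_i)_{i\ge0}$ (a point of the $p$-odometer written in base $p$), let $s_i(x)=x^{(i)}_1x^{(i)}_2\cdots x^{(i)}_{p-1-\delta_i}$ (the empty word if $\delta_i=p-1$), and let $\mathcal I^+(x)=\{i\ge 0: s_i(x)\text{ is not empty}\}$. If $\mathcal I^+(x)$ is finite, let $k^+(x)=\max\{|x_0\,s_0(x)\,\tau(s_1(x))\cdots\tau^i(s_i(x))| : i\in\mathcal I^+(x)\}$, with $k^+(x)=|x_0|=1$ if $\mathcal I^+(x)=\emptyset$. The set $\mathcal I^+(x)$ and the number $k^+(x)$ depend only on $\pi(x)$. **Proposition 3.4.** Let $x,y\in X_\tau$ with $\pi(x)=\pi(y)$; put $\mathcal I=\mathcal I^+(x)=\mathcal I^+(y)$ and, if $\mathcal I$ is finite, $k=k^+(x)=k^+(y)$. 1. $(x,y)$ is asymptotic if and only if either $\mathcal I$ is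 infinite and $s_i(x)=s_i(y)$ for all sufficiently large $i$, or $\mathcal I$ is finite and $s_i(T^kx)=s_i(T^ky)$ for all sufficiently large $i$. 2. Assume that $\tau$ has no coincidences, i.e. for all letters $a\ne b$ the words $\tau(a)$ and $\tau(b)$ differ at every coordinate. If there is $i\in\mathbb Z$ with $x_i\neq y_i$ and $\mathcal I^+(T^ix)$ infinite, then $(x,y)$ is distal; otherwise $(x,y)$ is asymptotic. Moreover, if $\tau$ has no coincidences, then $(X_\tau,T)$ has no Li–Yorke pairs at all (whether or not in the same fibre of $\pi$). -/

import Mathlib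

open Filter Topology

namespace Subst

noncomputable section

/-! ### Pairs in a dynamical system

`X` is the phase space inside the ambient set `E`, `ρ` the distance, `T` the transformation. -/

/-- Distal pairs of `(X, T)`: `liminf ρ (T^n x) (T^n y) > 0`. -/
def distalPairs {E : Type*} (X : Set E) (ρ : E → E → ℝ) (T : E → E) : Set (E × E) :=
  {q | q.1 ∈ X ∧ q.2 ∈ X ∧ 0 < liminf (fun n : ℕ => ρ (T^[n] q.1) (T^[n] q.2)) atTop}

/-- Proximal pairs of `(X, T)`: `liminf ρ (T^n x) (T^n y) = 0`. -/
def proximalPairs {E : Type*} (X : Set E) (ρ : E → E → ℝ) (T : E → E) : Set (E × E) :=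
  {q | q.1 ∈ X ∧ q.2 ∈ X ∧ liminf (fun n : ℕ => ρ (T^[n] q.1) (T^[n] q.2)) atTop = 0}

/-- Asymptotic pairs of `(X, T)`: `lim ρ (T^n x) (T^n y) = 0`. -/
def asymptoticPairs {E : Type*} (X : Set E) (ρ : E → E → ℝ) (T : E → E) : Set (E × E) :=
  {q | q.1 ∈ X ∧ q.2 ∈ X ∧ Tendsto (fun n : ℕ => ρ (T^[n] q.1) (T^[n] q.2)) atTop (𝓝 0)}

/-- Li-Yorke pairs: proximal and not asymptotic. -/
def liYorkePairs {E : Type*} (X : Set E) (ρ : E → E → ℝ) (T : E → E) : Set (E × E) :=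
  proximalPairs X ρ T \ asymptoticPairs X ρ T

/-! ### Two-sided sequences -/

/-- The shift map `T` on two-sided sequences. -/
def shift {A : Type*} (x : ℤ → A) : ℤ → A := fun i => x (i + 1)

/-- The power `T ^ n` of the shift, for an integer `n`. -/
def shiftPow {A : Type*} (n : ℤ) (x : ℤ → A) : ℤ → A := fun i => x (i + n)

theorem shift_iterate {A : Type*} (n : ℕ) (x : ℤ → A) : shift^[n] x = shiftPow n x := by
  induction n generalizing x with
  | zero => funext i; simp [shiftPow]
  | succ n ih =>
    rw [Function.iterate_succ_apply, ih]
    funext i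
    simp only [shiftPow, shift]
    congr 1
    push_cast
    ring

theorem shiftPow_add {A : Type*} (m n : ℤ) (x : ℤ → A) :
    shiftPow m (shiftPow n x) = shiftPow (m + n) x := by
  funext i
  simp only [shiftPow]
  congr 1
  ring

open scoped Classical in
/-- The usual distance on two-sided sequences, compatible with the product of the discrete
topologies: `2 ^ (-N)`, where `N` is the least `|i|` with `x i ≠ y i`, and `0` if `x = y`. -/
def seqDist {A : Type*} (x y : ℤ → A) : ℝ :=
  if x = y then 0 else (1 / 2 : ℝ) ^ sInf {n : ℕ | ∃ i : ℤ, i.natAbs = n ∧ x i ≠ y i}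

/-- The sub-word of `x` of length `m` which starts at the coordinate `i`. -/
def subword {A : Type*} (x : ℤ → A) (i : ℤ) (m : ℕ) : List A :=
  List.ofFn fun j : Fin m => x (i + (j : ℕ))

/-! ### Substitutions of constant length `p`

Such a substitution sends each letter to a word of length `p`; it is a map `A → Fin p → A`. -/

/-- Extension of `τ` to finite words by concatenation. -/
def wordMap {A : Type*} {p : ℕ} (τ : A → Fin p → A) (w : List A) : List A :=
  w.flatMap fun a => List.ofFn (τ a)

/-- Extension of `τ` to two-sided sequences, `… τ(x₋₁) . τ(x₀) τ(x₁) …`: the coordinate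
`p * m + j` with `0 ≤ j < p` is the `j`-th letter of `τ (x m)`. -/
def seqMap {A : Type*} {p : ℕ} [NeZero p] (τ : A → Fin p → A) (x : ℤ → A) : ℤ → A :=
  fun n => τ (x (n / (p : ℤ))) (Fin.ofNat p (n % (p : ℤ)).toNat)

/-- For some `n`, every letter occurs in the `n`-th image of every letter. -/
def IsPrimitive {A : Type*} {p : ℕ} (τ : A → Fin p → A) : Prop :=
  ∃ n : ℕ, ∀ a b : A, a ∈ (wordMap τ)^[n] [b]

/-- The substitution subshift `X_τ`: the two-sided sequences all of whose finite sub-words occur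
in some `τ^n(a)`. -/
def substShift {A : Type*} {p : ℕ} (τ : A → Fin p → A) : Set (ℤ → A) :=
  {x | ∀ (i : ℤ) (m : ℕ), ∃ (n : ℕ) (a : A), subword x i m <:+: (wordMap τ)^[n] [a]}

/-- The images of two distinct letters agree at some coordinate. -/
def HasCoincidence {A : Type*} {p : ℕ} (τ : A → Fin p → A) : Prop :=
  ∃ a b : A, a ≠ b ∧ ∃ j : Fin p, τ a j = τ b j

/-- `z i = x^(i)` and `δ` are the points of `X_τ` and the digits associated with `x`:
`x^(0) = x` and `τ(x^(i+1)) = T^(-δ_i) x^(i)`. -/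
def IsExpansion {A : Type*} {p : ℕ} [NeZero p] (τ : A → Fin p → A) (x : ℤ → A)
    (z : ℕ → ℤ → A) (δ : ℕ → Fin p) : Prop :=
  z 0 = x ∧ (∀ i, z i ∈ substShift τ) ∧
    ∀ i, seqMap τ (z (i + 1)) = shiftPow (-((δ i : ℕ) : ℤ)) (z i)

open scoped Classical in
/-- The sequences `(x^(i))` and `(δ_i)` of `x`. For a primitive `τ` with infinite `X_τ` they exist
and are unique for every `x ∈ X_τ`; the value is irrelevant when none exist. -/
def expansion {A : Type*} {p : ℕ} [NeZero p] (τ : A → Fin p → A) (x : ℤ → A) :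
    (ℕ → ℤ → A) × (ℕ → Fin p) :=
  if h : ∃ q : (ℕ → ℤ → A) × (ℕ → Fin p), IsExpansion τ x q.1 q.2 then h.choose
  else (fun _ => x, fun _ => 0)

/-- The point `x^(i)`. -/
def desub {A : Type*} {p : ℕ} [NeZero p] (τ : A → Fin p → A) (x : ℤ → A) (i : ℕ) : ℤ → A :=
  (expansion τ x).1 i

/-- The map `π` to the `p`-odometer, whose points are written as digit sequences in base `p`. -/
def odometerMap {A : Type*} {p : ℕ} [NeZero p] (τ : A → Fin p → A) (x : ℤ → A) : ℕ → Fin p :=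
  (expansion τ x).2

/-- The word `s_i(x)`, that is `x^(i)` read from coordinate `1` to `p - 1 - δ_i`
(the empty word if `δ_i = p - 1`). -/
def sWord {A : Type*} {p : ℕ} [NeZero p] (τ : A → Fin p → A) (x : ℤ → A) (i : ℕ) : List A :=
  subword (desub τ x i) 1 (p - 1 - (odometerMap τ x i : ℕ))

/-- The set `I⁺(x)` of the `i` with `|s_i(x)| ≠ 0`. -/
def iPlus {A : Type*} {p : ℕ} [NeZero p] (τ : A → Fin p → A) (x : ℤ → A) : Set ℕ :=
  {i | (sWord τ x i).length ≠ 0}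

/-- The word `x_0 s_0(x) τ(s_1(x)) ⋯ τ^i(s_i(x))`. -/
def rightWord {A : Type*} {p : ℕ} [NeZero p] (τ : A → Fin p → A) (x : ℤ → A) (i : ℕ) : List A :=
  x 0 :: (List.range (i + 1)).flatMap fun j => (wordMap τ)^[j] (sWord τ x j)

/-- `k⁺(x)`, the largest length of the words `x_0 s_0(x) τ(s_1(x)) ⋯ τ^i(s_i(x))` for `i ∈ I⁺(x)`.
It is meant for finite `I⁺(x)`. When `I⁺(x)` is empty only the letter `x_0` is left and the value
is `1`; inserting `1` changes nothing otherwise. -/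
def kPlus {A : Type*} {p : ℕ} [NeZero p] (τ : A → Fin p → A) (x : ℤ → A) : ℕ :=
  sSup (insert 1 {n : ℕ | ∃ i ∈ iPlus τ x, n = (rightWord τ x i).length})

end

end Subst


/-!
Two facts carry the proof.

* *Recognizability.* If `X_τ` is infinite, compactness gives two of its points with a last
  coordinate at which they differ. Each letter pair that occurs in this way has a preimage under `τ`
  which occurs in the same way. As a pair has at most one image and there are finitely many pairs,
  the preimage is unique, and so is the residue modulo `p` of the last coordinate. Hence a point of
  `X_τ` is cut into images of letters in one way only.
* *Carries.* With `c 0 = m` and `c (n + 1) = ⌊(c n + δ n) / p⌋`, the letter `x m` lies in the word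
  of length `p ^ n` which comes from the letter `x^(n)` at the coordinate `c n`, and `T^m` acts on
  the digits of `x` as addition of `m` with these carries. The carry is `0` as long as `m` falls
  inside the first `|x_0 s_0(x) ⋯ τ^(n-1)(s_(n-1)(x))|` coordinates, and `τ^n(s_n(x))` consists of
  the coordinates of carry between `1` and `p - 1 - δ n`.

Suppose that `s_n(x)` is nonempty for infinitely many `n`, which a shift always achieves. Then two
points with the same digits agree from some coordinate on exactly when their words `s_n` agree for
large `n`. Without coincidences a single difference propagates to all coordinates of eventually
equal carries, which makes the pair distal.
-/

namespace Subst

/-! ### Words and minimality -/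

section Words

variable {A B : Type*}

theorem isInfix_of_append_eq {s l t a m c : List A} (h : s ++ l ++ t = a ++ m ++ c)
    (hsa : s.length ≤ a.length) (hml : a.length + m.length ≤ s.length + l.length) : m <:+: l := by
  obtain ⟨r, rfl⟩ : s <+: a :=
    List.prefix_of_prefix_length_le ⟨l ++ t, by rw [← List.append_assoc, h]⟩
      ⟨m ++ c, (List.append_assoc _ _ _).symm⟩ hsa
  have hrest : l ++ t = r ++ m ++ c := by
    simpa only [List.append_assoc, List.append_right_inj] using h
  have hprefix : r ++ m <+: l :=
    List.prefix_of_prefix_length_le ⟨c, hrest.symm⟩ ⟨t, rfl⟩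
      (by simp only [List.length_append] at hml ⊢; omega)
  exact (List.suffix_append r m).isInfix.trans hprefix.isInfix

theorem exists_mem_isInfix_of_isInfix_flatMap {f : B → List A} {L : ℕ} (hL : 0 < L)
    (hf : ∀ b, (f b).length = L) {w : List B} {l : List A} (hl : 2 * L ≤ l.length)
    (h : l <:+: w.flatMap f) : ∃ b ∈ w, f b <:+: l := by
  obtain ⟨s, t, hst⟩ := h
  have hlength (v : List B) : (v.flatMap f).length = v.length * L := by
    simp [List.length_flatMap, hf]
  have hw : s.length + l.length + t.length = w.length * L := by
    rw [← hlength, ← hst, List.length_append, List.length_append]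
  set q := (s.length + (L - 1)) / L
  have hle : q * L ≤ s.length + (L - 1) := Nat.div_mul_le_self _ _
  have hlt : s.length + (L - 1) < q * L + L := Nat.lt_div_mul_add hL
  have hqw : q < w.length := Nat.lt_of_mul_lt_mul_right (a := L) (by omega)
  have hcut : w.flatMap f = (w.take q).flatMap f ++ f w[q] ++ (w.drop (q + 1)).flatMap f := by
    rw [List.append_assoc, ← List.flatMap_cons, ← List.flatMap_append,
      ← List.drop_eq_getElem_cons hqw, List.take_append_drop]
  have htake : ((w.take q).flatMap f).length = q * L := by
    rw [hlength, List.length_take, min_eq_left hqw.le]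
  exact ⟨w[q], List.getElem_mem hqw,
    isInfix_of_append_eq (hst.trans hcut) (by omega) (by rw [htake, hf]; omega)⟩

@[simp]
theorem length_subword (x : ℤ → A) (i : ℤ) (m : ℕ) : (subword x i m).length = m :=
  List.length_ofFn

theorem subword_add (x : ℤ → A) (i : ℤ) (m n : ℕ) :
    subword x i (m + n) = subword x i m ++ subword x (i + m) n := by
  simp [subword, List.ofFn_add, add_assoc]

theorem subword_shiftPow (x : ℤ → A) (k i : ℤ) (m : ℕ) :
    subword (shiftPow k x) i m = subword x (i + k) m := by
  simp only [subword, shiftPow, add_right_comm]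

theorem subword_eq_iff {x y : ℤ → A} {i : ℤ} {m : ℕ} :
    subword x i m = subword y i m ↔ Set.EqOn x y (Set.Ico i (i + m)) := by
  rw [subword, subword, List.ofFn_inj, funext_iff]
  refine ⟨fun h j ⟨hj, hjm⟩ => ?_, fun h j => h ⟨by omega, by omega⟩⟩
  simpa [Int.toNat_of_nonneg (sub_nonneg.2 hj)] using h ⟨(j - i).toNat, by omega⟩

theorem subword_isInfix (x : ℤ → A) {i k : ℤ} {m n : ℕ} (hki : k ≤ i) (hmn : i + m ≤ k + n) :
    subword x i m <:+: subword x k n := by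
  obtain ⟨a, rfl⟩ := Int.le.dest hki
  obtain ⟨b, rfl⟩ : ∃ b, n = a + m + b := ⟨n - (a + m), by omega⟩
  rw [subword_add, subword_add]
  exact ⟨_, _, rfl⟩

theorem exists_eq_subword_of_isInfix {x : ℤ → A} {i : ℤ} {n : ℕ} {l : List A}
    (h : l <:+: subword x i n) : ∃ k : ℤ, l = subword x k l.length := by
  obtain ⟨s, t, hst⟩ := h
  obtain rfl : n = s.length + l.length + t.length := by
    simpa [add_assoc] using congrArg List.length hst.symm
  rw [subword_add, subword_add] at hst
  exact ⟨_, List.append_inj_right (List.append_inj_left hst (by simp)) (by simp)⟩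

variable {p : ℕ} (τ : A → Fin p → A)

theorem wordMap_append (v w : List A) : wordMap τ (v ++ w) = wordMap τ v ++ wordMap τ w :=
  List.flatMap_append

theorem wordMap_iterate_append (n : ℕ) (v w : List A) :
    (wordMap τ)^[n] (v ++ w) = (wordMap τ)^[n] v ++ (wordMap τ)^[n] w := by
  induction n generalizing v w with
  | zero => rfl
  | succ n ih => simp only [Function.iterate_succ_apply, wordMap_append, ih]

theorem isInfix_wordMap_iterate (n : ℕ) {v w : List A} (h : v <:+: w) :
    (wordMap τ)^[n] v <:+: (wordMap τ)^[n] w := by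
  obtain ⟨s, t, rfl⟩ := h
  rw [wordMap_iterate_append, wordMap_iterate_append]
  exact ⟨_, _, rfl⟩

theorem length_wordMap_iterate (n : ℕ) (w : List A) :
    ((wordMap τ)^[n] w).length = w.length * p ^ n := by
  induction n generalizing w with
  | zero => simp
  | succ n ih =>
    simp [Function.iterate_succ_apply, ih, wordMap, List.length_flatMap, pow_succ', mul_assoc]

theorem wordMap_iterate_eq_flatMap (n : ℕ) (w : List A) :
    (wordMap τ)^[n] w = w.flatMap fun a => (wordMap τ)^[n] [a] := by
  induction w with
  | nil => exact List.eq_nil_of_length_eq_zero (by simp [length_wordMap_iterate])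
  | cons a w ih => rw [List.flatMap_cons, ← ih, ← wordMap_iterate_append, List.singleton_append]

variable {τ}

theorem shiftPow_mem_substShift {x : ℤ → A} (hx : x ∈ substShift τ) (k : ℤ) :
    shiftPow k x ∈ substShift τ := fun i m => by
  rw [subword_shiftPow]
  exact hx (i + k) m

theorem exists_subword_shiftPow_eq [NeZero p] (hprim : IsPrimitive τ) {x u : ℤ → A}
    (hx : x ∈ substShift τ) (hu : u ∈ substShift τ) (i : ℤ) (m : ℕ) :
    ∃ k : ℤ, subword (shiftPow k u) i m = subword x i m := by
  obtain ⟨n, a, hxa⟩ := hx i m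
  obtain ⟨n₀, hn₀⟩ := hprim
  have hp := NeZero.pos p
  have hL : 0 < p ^ (n + n₀) := Nat.pow_pos hp
  obtain ⟨n₁, c, huc⟩ := hu 0 (2 * p ^ (n + n₀))
  have hle : n + n₀ ≤ n₁ := by
    by_contra! hlt
    have hlen := huc.length_le
    rw [length_subword, length_wordMap_iterate, List.length_singleton, one_mul] at hlen
    have := Nat.pow_le_pow_right hp hlt.le
    omega
  obtain ⟨r, rfl⟩ := Nat.exists_eq_add_of_le hle
  rw [Function.iterate_add_apply, wordMap_iterate_eq_flatMap] at huc
  obtain ⟨b, -, hb⟩ := exists_mem_isInfix_of_isInfix_flatMap hL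
    (fun b => by simp [length_wordMap_iterate]) (by simp) huc
  have hab : (wordMap τ)^[n] [a] <:+: (wordMap τ)^[n + n₀] [b] := by
    rw [Function.iterate_add_apply]
    obtain ⟨s, t, hst⟩ := List.append_of_mem (hn₀ a b)
    exact isInfix_wordMap_iterate τ n ⟨s, t, by simp [hst]⟩
  obtain ⟨k, hk⟩ := exists_eq_subword_of_isInfix ((hxa.trans hab).trans hb)
  exact ⟨k - i, by rw [subword_shiftPow, add_sub_cancel, hk, length_subword]⟩

end Words

/-! ### Division by `p` and the map on sequences -/

section Digits

variable {p : ℕ} [NeZero p]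

variable (p) in
/-- The residue of an integer modulo `p`, as an index into the words `τ a`: the coordinate `n` of
`seqMap τ u` is by definition `τ (u (n / p)) (lowDigit p n)`. -/
def lowDigit (n : ℤ) : Fin p := Fin.ofNat p (n % p).toNat

variable (p) in
theorem natCast_pos : (0 : ℤ) < p := by exact_mod_cast NeZero.pos p

variable (p) in
theorem coe_lowDigit (n : ℤ) : ((lowDigit p n : ℕ) : ℤ) = n % p := by
  have hnonneg := Int.emod_nonneg n (natCast_pos p).ne'
  have hlt := Int.emod_lt_of_pos n (natCast_pos p)
  rw [lowDigit, Fin.val_ofNat, Nat.mod_eq_of_lt (by omega), Int.toNat_of_nonneg hnonneg]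

variable (p) in
theorem mul_ediv_add_lowDigit (n : ℤ) : p * (n / p) + (lowDigit p n : ℕ) = n := by
  rw [coe_lowDigit, Int.mul_ediv_add_emod]

theorem mul_add_ediv (m : ℤ) (t : Fin p) : (p * m + (t : ℕ)) / p = m := by
  rw [Int.add_comm, Int.add_mul_ediv_left _ _ (natCast_pos p).ne',
    Int.ediv_eq_zero_of_lt (by omega) (by omega), zero_add]

theorem lowDigit_mul_add (m : ℤ) (t : Fin p) : lowDigit p (p * m + (t : ℕ)) = t := by
  have h := mul_ediv_add_lowDigit p (p * m + (t : ℕ))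
  rw [mul_add_ediv] at h
  exact Fin.ext (by omega)

theorem lowDigit_natCast (t : Fin p) : lowDigit p (t : ℕ) = t := by
  simpa using lowDigit_mul_add 0 t

theorem lowDigit_eq_iff {m n : ℤ} : lowDigit p m = lowDigit p n ↔ m ≡ n [ZMOD p] := by
  rw [Fin.ext_iff, ← Nat.cast_inj (R := ℤ), coe_lowDigit, coe_lowDigit, Int.ModEq]

variable {A : Type*} {τ : A → Fin p → A}

theorem seqMap_apply (u : ℤ → A) (m : ℤ) (t : Fin p) :
    seqMap τ u (p * m + (t : ℕ)) = τ (u m) t :=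
  congrArg₂ (fun i => τ (u i)) (mul_add_ediv m t) (lowDigit_mul_add m t)

variable (τ) in
theorem seqMap_shiftPow (k : ℤ) (u : ℤ → A) :
    seqMap τ (shiftPow k u) = shiftPow (p * k) (seqMap τ u) := by
  funext n
  rw [← mul_ediv_add_lowDigit p n, seqMap_apply, shiftPow, shiftPow, add_right_comm, ← mul_add,
    seqMap_apply]

theorem seqMap_injective (hinj : Function.Injective τ) :
    Function.Injective (seqMap τ : (ℤ → A) → ℤ → A) := fun u v h =>
  funext fun m => hinj <| funext fun t => by
    simpa only [seqMap_apply] using congrFun h (p * m + (t : ℕ))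

theorem subword_seqMap (u : ℤ → A) (q : ℤ) (m : ℕ) :
    subword (seqMap τ u) (p * q) (m * p) = wordMap τ (subword u q m) := by
  induction m with
  | zero => simp [subword, wordMap]
  | succ m ih =>
    rw [add_mul, one_mul, subword_add, subword_add, wordMap_append, ih, Nat.cast_mul,
      mul_comm (m : ℤ), ← mul_add]
    simp [subword, wordMap, seqMap_apply]

theorem seqMap_mem_substShift {u : ℤ → A} (hu : u ∈ substShift τ) :
    seqMap τ u ∈ substShift τ := fun i m => by
  obtain ⟨n, a, h⟩ := hu (i / p) (m + 1)
  have hblock : subword (seqMap τ u) i m <:+: wordMap τ (subword u (i / p) (m + 1)) := by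
    rw [← subword_seqMap]
    have hi := mul_ediv_add_lowDigit p i
    have hm : m ≤ m * p := Nat.le_mul_of_pos_right m (NeZero.pos p)
    exact subword_isInfix _ (by omega) (by push_cast [add_mul]; zify at hm; omega)
  refine ⟨n + 1, a, hblock.trans ?_⟩
  rw [Function.iterate_succ_apply']
  exact isInfix_wordMap_iterate τ 1 h

end Digits

/-! ### Compactness -/

section Compactness

variable {A : Type*} [TopologicalSpace A]

theorem continuous_shiftPow (k : ℤ) : Continuous (shiftPow k : (ℤ → A) → ℤ → A) :=
  continuous_pi fun i => continuous_apply (i + k)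

variable [DiscreteTopology A] {p : ℕ} (τ : A → Fin p → A)

theorem isClosed_substShift : IsClosed (substShift τ) := by
  have h : substShift τ = ⋂ (i : ℤ) (m : ℕ), (fun (x : ℤ → A) (j : Fin m) => x (i + (j : ℕ))) ⁻¹'
      {f | ∃ (n : ℕ) (a : A), List.ofFn f <:+: (wordMap τ)^[n] [a]} := by
    ext x
    simp [substShift, subword]
  rw [h]
  exact isClosed_iInter fun i => isClosed_iInter fun m => (isClosed_discrete _).preimage <|
    continuous_pi fun j => continuous_apply _

theorem continuous_seqMap [NeZero p] : Continuous (seqMap τ : (ℤ → A) → ℤ → A) :=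
  continuous_pi fun n =>
    (continuous_of_discreteTopology (f := fun a => τ a (lowDigit p n))).comp (continuous_apply _)

variable [Finite A]

theorem exists_mem_eqOn_iUnion {K : Set ((ℤ → A) × (ℤ → A))} (hK : IsClosed K) {S : ℕ → Set ℤ}
    (hS : Monotone S) (h : ∀ N, ∃ q ∈ K, Set.EqOn q.1 q.2 (S N)) :
    ∃ q ∈ K, Set.EqOn q.1 q.2 (⋃ N, S N) := by
  have hclosed (N : ℕ) : IsClosed (K ∩ {q | Set.EqOn q.1 q.2 (S N)}) := by
    have : {q : (ℤ → A) × (ℤ → A) | Set.EqOn q.1 q.2 (S N)} = ⋂ i ∈ S N, {q | q.1 i = q.2 i} := by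
      ext q
      simp [Set.EqOn]
    rw [this]
    exact hK.inter <| isClosed_biInter fun i _ =>
      isClosed_eq ((continuous_apply i).comp continuous_fst)
        ((continuous_apply i).comp continuous_snd)
  obtain ⟨q, hq⟩ := IsCompact.nonempty_iInter_of_sequence_nonempty_isCompact_isClosed
    (fun N => K ∩ {q | Set.EqOn q.1 q.2 (S N)})
    (fun N q hq => ⟨hq.1, hq.2.mono (hS (Nat.le_succ N))⟩) h (hclosed 0).isCompact hclosed
  rw [Set.mem_iInter] at hq
  refine ⟨q, (hq 0).1, fun i hi => ?_⟩
  obtain ⟨N, hN⟩ := Set.mem_iUnion.1 hi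
  exact (hq N).2 hN

theorem exists_mem_diag {K : Set ((ℤ → A) × (ℤ → A))} (hK : IsClosed K)
    (h : ∀ N : ℕ, ∃ q ∈ K, Set.EqOn q.1 q.2 (Set.Ico (-N : ℤ) N)) : ∃ x, (x, x) ∈ K := by
  obtain ⟨⟨x, y⟩, hxyK, hxy⟩ := exists_mem_eqOn_iUnion hK
    (fun M N hMN => Set.Ico_subset_Ico (by simpa using hMN) (by exact_mod_cast hMN)) h
  obtain rfl : x = y := funext fun i =>
    hxy (Set.mem_iUnion.2 ⟨i.natAbs + 1, by omega, by omega⟩)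
  exact ⟨x, hxyK⟩

variable {τ}

theorem substShift_subset_of_isClosed [NeZero p] (hprim : IsPrimitive τ) {u : ℤ → A}
    (hu : u ∈ substShift τ) {C : Set (ℤ → A)} (hC : IsClosed C) (huC : ∀ k, shiftPow k u ∈ C) :
    substShift τ ⊆ C := by
  intro x hx
  obtain ⟨y, rfl, hyC⟩ := exists_mem_diag ((isClosed_singleton (x := x)).prod hC) fun N => by
    obtain ⟨k, hk⟩ := exists_subword_shiftPow_eq hprim hx hu (-N) (2 * N)
    refine ⟨(x, shiftPow k u), ⟨rfl, huC k⟩, (subword_eq_iff.1 hk.symm).mono ?_⟩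
    exact Set.Ico_subset_Ico_right (by push_cast; omega)
  exact hyC

end Compactness

/-! ### Last differences -/

section LastDiff

/-- `t` is the largest index at which `f` and `g` differ. It serves both for two-sided sequences
and for the words `τ a`, which are indexed by `Fin p`. -/
def IsLastDiff {ι α : Type*} [Preorder ι] (f g : ι → α) (t : ι) : Prop :=
  f t ≠ g t ∧ Set.EqOn f g (Set.Ioi t)

theorem IsLastDiff.unique {ι α : Type*} [LinearOrder ι] {f g : ι → α} {s t : ι}
    (hs : IsLastDiff f g s) (ht : IsLastDiff f g t) : s = t :=
  le_antisymm (not_lt.1 fun hts => hs.1 (ht.2 hts)) (not_lt.1 fun hst => ht.1 (hs.2 hst))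

variable {A : Type*}

theorem IsLastDiff.shiftPow {x y : ℤ → A} {r : ℤ} (h : IsLastDiff x y r) (k : ℤ) :
    IsLastDiff (shiftPow k x) (shiftPow k y) (r - k) :=
  ⟨by simpa [Subst.shiftPow] using h.1, fun i (hi : r - k < i) => h.2 (sub_lt_iff_lt_add.1 hi)⟩

section SeqMap

variable {p : ℕ} [NeZero p] {τ : A → Fin p → A} {u v : ℤ → A} {n : ℤ}

theorem IsLastDiff.apply_of_seqMap (h : IsLastDiff (seqMap τ u) (seqMap τ v) n) :
    IsLastDiff (τ (u (n / p))) (τ (v (n / p))) (lowDigit p n) := by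
  refine ⟨h.1, fun s hs => ?_⟩
  have hns : n < p * (n / p) + (s : ℕ) := by
    have := mul_ediv_add_lowDigit p n
    have : (lowDigit p n : ℕ) < s := hs
    omega
  simpa only [seqMap_apply] using h.2 hns

theorem IsLastDiff.of_seqMap (hinj : Function.Injective τ)
    (h : IsLastDiff (seqMap τ u) (seqMap τ v) n) : IsLastDiff u v (n / p) := by
  refine ⟨fun huv => h.1 (by simp only [seqMap, huv]), fun i hi => hinj <| funext fun s => ?_⟩
  have hni : n < p * i + (s : ℕ) := by
    have := (Int.ediv_lt_iff_lt_mul (natCast_pos p)).1 hi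
    rw [mul_comm]
    omega
  simpa only [seqMap_apply] using h.2 hni

end SeqMap

theorem exists_nat_forall_eqOn_Ico_imp_eq [Finite A] [TopologicalSpace A] [DiscreteTopology A]
    {X : Set (ℤ → A)} (hX : IsClosed X)
    (h : ∀ x ∈ X, ∀ y ∈ X, ¬IsLastDiff x y (-1)) :
    ∃ N : ℕ, ∀ x ∈ X, ∀ y ∈ X, Set.EqOn x y (Set.Ico 0 N) → x (-1) = y (-1) := by
  by_contra! hcon
  have hK : IsClosed ((X ×ˢ X) ∩ {q : (ℤ → A) × (ℤ → A) | q.1 (-1) ≠ q.2 (-1)}) :=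
    (hX.prod hX).inter <| (isClosed_discrete {q : A × A | q.1 ≠ q.2}).preimage
      (f := fun q : (ℤ → A) × (ℤ → A) => (q.1 (-1), q.2 (-1))) (by fun_prop)
  obtain ⟨⟨x, y⟩, ⟨⟨hx, hy⟩, hne⟩, hxy⟩ := exists_mem_eqOn_iUnion hK
    (S := fun N => Set.Ico 0 (N : ℤ))
    (fun M N hMN => Set.Ico_subset_Ico_right (by exact_mod_cast hMN))
    (fun N => by
      obtain ⟨x, hx, y, hy, hxy, hne⟩ := hcon N
      exact ⟨(x, y), ⟨⟨hx, hy⟩, hne⟩, hxy⟩)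
  refine h x hx y hy ⟨hne, fun i (hi : -1 < i) => hxy (Set.mem_iUnion.2 ⟨i.toNat + 1, ?_⟩)⟩
  exact ⟨by omega, by push_cast; omega⟩

theorem eqOn_Iio_of_eqOn_Ico {X : Set (ℤ → A)} (hshift : ∀ x ∈ X, ∀ k, shiftPow k x ∈ X) {N : ℕ}
    (hN : ∀ x ∈ X, ∀ y ∈ X, Set.EqOn x y (Set.Ico 0 N) → x (-1) = y (-1)) {x y : ℤ → A}
    (hx : x ∈ X) (hy : y ∈ X) {l : ℤ} (h : Set.EqOn x y (Set.Ico l (l + N))) :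
    Set.EqOn x y (Set.Iio (l + N)) := by
  have hstep (d : ℕ) : Set.EqOn x y (Set.Ico (l - d) (l + N)) := by
    induction d with
    | zero => simpa using h
    | succ d ih =>
      have hleft : x (l - d - 1) = y (l - d - 1) := by
        have := hN _ (hshift x hx (l - d)) _ (hshift y hy (l - d)) fun i hi =>
          ih ⟨by simpa using hi.1, by have := hi.2; omega⟩
        simpa only [shiftPow, neg_add_eq_sub] using this
      intro i hi
      rcases eq_or_lt_of_le hi.1 with rfl | hlt
      · rwa [Nat.cast_succ, ← sub_sub]
      · exact ih ⟨by push_cast at hlt; omega, hi.2⟩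
  exact fun i hi => hstep (l - i).toNat ⟨by omega, hi⟩

theorem finite_of_eqOn_Iio_of_eqOn_Ico [Finite A] {X : Set (ℤ → A)} {N : ℕ}
    (h : ∀ x ∈ X, ∀ y ∈ X, ∀ l : ℤ, Set.EqOn x y (Set.Ico l (l + N)) →
      Set.EqOn x y (Set.Iio (l + N))) : X.Finite := by
  by_contra hinf
  have := Fintype.ofFinite (Fin N → A)
  obtain ⟨F, hFX, hFcard⟩ :=
    Set.Infinite.exists_subset_card_eq hinf (Fintype.card (Fin N → A) + 1)
  have hseparated : ∀ᶠ l : ℤ in atTop, ∀ x ∈ F, ∀ y ∈ F, Set.EqOn x y (Set.Iio l) → x = y := by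
    simp only [Filter.eventually_all_finset]
    intro x _ y _
    by_cases hxy : x = y
    · exact .of_forall fun _ _ => hxy
    · obtain ⟨i, hi⟩ := Function.ne_iff.1 hxy
      filter_upwards [eventually_gt_atTop i] with l hl heq using absurd (heq hl) hi
  obtain ⟨l, hl⟩ := hseparated.exists
  obtain ⟨x, hx, y, hy, hxy, heq⟩ := Finset.exists_ne_map_eq_of_card_lt_of_maps_to
    (t := Finset.univ) (f := fun x (j : Fin N) => x (l - N + (j : ℕ)))
    (by rw [hFcard, Finset.card_univ]; exact Nat.lt_succ_self _) (fun x (_ : x ∈ F) => by simp)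
  have hwindow : Set.EqOn x y (Set.Ico (l - N) (l - N + N)) :=
    subword_eq_iff.1 (congrArg List.ofFn heq)
  exact hxy (hl x hx y hy (by simpa using h x (hFX hx) y (hFX hy) _ hwindow))

theorem exists_isLastDiff [Finite A] [TopologicalSpace A] [DiscreteTopology A] {X : Set (ℤ → A)}
    (hX : IsClosed X) (hshift : ∀ x ∈ X, ∀ k, shiftPow k x ∈ X) (hinf : X.Infinite) :
    ∃ x ∈ X, ∃ y ∈ X, ∃ r, IsLastDiff x y r := by
  by_contra! h
  obtain ⟨N, hN⟩ := exists_nat_forall_eqOn_Ico_imp_eq hX fun x hx y hy => h x hx y hy (-1)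
  exact hinf <| finite_of_eqOn_Iio_of_eqOn_Ico fun x hx y hy _ =>
    eqOn_Iio_of_eqOn_Ico hshift hN hx hy

end LastDiff

/-! ### Recognizability -/

/-- Agreement on arbitrarily long intervals; both proximal pairs and pairs of sequences which agree
from some coordinate on have this property. -/
def EqOnLongIntervals {A : Type*} (x y : ℤ → A) : Prop :=
  ∀ N : ℕ, ∃ m : ℤ, Set.EqOn x y (Set.Ico m (m + N))

theorem IsLastDiff.eqOnLongIntervals {A : Type*} {x y : ℤ → A} {r : ℤ} (h : IsLastDiff x y r) :
    EqOnLongIntervals x y :=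
  fun _ => ⟨r + 1, h.2.mono fun _ hi => Int.lt_of_add_one_le hi.1⟩

section Layers

variable {A : Type*} {p : ℕ} [NeZero p] {τ : A → Fin p → A}

variable (τ) in
/-- The image `T ^ j (τ (X_τ))`: the sequences cut into images of letters in such a way that an
image starts at the coordinate `-j`. -/
def layer (j : ℤ) : Set (ℤ → A) := shiftPow (-j) ⁻¹' (seqMap τ '' substShift τ)

theorem shiftPow_zero (x : ℤ → A) : shiftPow 0 x = x := by
  simp [funext_iff, shiftPow]

theorem layer_add (j k : ℤ) : layer τ (j + k) = shiftPow (-k) ⁻¹' layer τ j := by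
  ext x
  simp only [layer, Set.mem_preimage, shiftPow_add, neg_add]

theorem shiftPow_mem_layer {x : ℤ → A} {j : ℤ} (hx : x ∈ layer τ j) (k : ℤ) :
    shiftPow k x ∈ layer τ (j + k) := by
  rwa [layer_add, Set.mem_preimage, shiftPow_add, neg_add_cancel, shiftPow_zero]

theorem layer_mul_subset (k : ℤ) : layer τ (p * k) ⊆ layer τ 0 := by
  rintro x ⟨u, hu, hux⟩
  exact ⟨shiftPow k u, shiftPow_mem_substShift hu k, by rw [seqMap_shiftPow, hux, shiftPow_add,
    add_neg_cancel, neg_zero]⟩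

theorem layer_mul (k : ℤ) : layer τ (p * k) = layer τ 0 := by
  refine (layer_mul_subset k).antisymm fun x hx => ?_
  have h : shiftPow (-(p * k)) x ∈ layer τ (p * -k) := by
    simpa using shiftPow_mem_layer hx (-(p * k))
  simpa [shiftPow_add, shiftPow_zero] using shiftPow_mem_layer (layer_mul_subset (-k) h) (p * k)

theorem layer_congr {j k : ℤ} (h : j ≡ k [ZMOD p]) : layer τ j = layer τ k := by
  obtain ⟨c, rfl⟩ := (Int.modEq_iff_add_fac).1 h
  rw [add_comm j, layer_add _ j, layer_mul, ← layer_add, zero_add]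

theorem mem_substShift_of_mem_layer {x : ℤ → A} {j : ℤ} (hx : x ∈ layer τ j) :
    x ∈ substShift τ := by
  obtain ⟨u, hu, hux⟩ := hx
  have := shiftPow_mem_substShift (seqMap_mem_substShift hu) j
  rwa [hux, shiftPow_add, add_neg_cancel, shiftPow_zero] at this

variable [Finite A]

theorem isClosed_layer [TopologicalSpace A] [DiscreteTopology A] (j : ℤ) :
    IsClosed (layer τ j) :=
  ((isClosed_substShift τ).isCompact.image (continuous_seqMap τ)).isClosed.preimage
    (continuous_shiftPow (-j))

theorem layer_subset_of_inter_nonempty (hprim : IsPrimitive τ) {a b : ℤ}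
    (h : (layer τ a ∩ layer τ b).Nonempty) : layer τ a ⊆ layer τ b := by
  let _ : TopologicalSpace A := ⊥
  have : DiscreteTopology A := ⟨rfl⟩
  obtain ⟨z, ⟨u, hu, huz⟩, hzb⟩ := h
  have hcover : substShift τ ⊆ (shiftPow a ∘ seqMap τ) ⁻¹' layer τ b := by
    refine substShift_subset_of_isClosed hprim hu ((isClosed_layer b).preimage
      ((continuous_shiftPow a).comp (continuous_seqMap τ))) fun k => ?_
    have hz : shiftPow (p * k) z ∈ layer τ b := by
      have hmod : b + p * k ≡ b [ZMOD p] := by simp [Int.ModEq]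
      exact layer_congr hmod ▸ shiftPow_mem_layer hzb (p * k)
    simpa only [Set.mem_preimage, Function.comp_apply, seqMap_shiftPow, huz, shiftPow_add,
      add_neg_cancel_comm_assoc, add_neg_cancel_comm] using hz
  rintro w ⟨v, hv, hvw⟩
  have := hcover hv
  rwa [Set.mem_preimage, Function.comp_apply, hvw, shiftPow_add, add_neg_cancel,
    shiftPow_zero] at this

theorem layer_eq_of_inter_nonempty (hprim : IsPrimitive τ) {a b : ℤ}
    (h : (layer τ a ∩ layer τ b).Nonempty) : layer τ a = layer τ b :=
  (layer_subset_of_inter_nonempty hprim h).antisymm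
    (layer_subset_of_inter_nonempty hprim (Set.inter_comm _ _ ▸ h))

theorem exists_mem_layer (hprim : IsPrimitive τ) {x : ℤ → A} (hx : x ∈ substShift τ) :
    ∃ t : Fin p, x ∈ layer τ (t : ℕ) := by
  let _ : TopologicalSpace A := ⊥
  have : DiscreteTopology A := ⟨rfl⟩
  have hseq : seqMap τ x ∈ layer τ 0 := ⟨x, hx, by rw [neg_zero, shiftPow_zero]⟩
  refine Set.mem_iUnion.1 <| substShift_subset_of_isClosed hprim (seqMap_mem_substShift hx)
    (isClosed_iUnion_of_finite fun t : Fin p => isClosed_layer (t : ℕ)) (fun k => ?_) hx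
  have hk := shiftPow_mem_layer hseq k
  rw [zero_add, layer_congr (k := (lowDigit p k : ℕ)) (by simp [coe_lowDigit, Int.ModEq])] at hk
  exact Set.mem_iUnion.2 ⟨lowDigit p k, hk⟩

theorem EqOnLongIntervals.layer_inter_nonempty {x y : ℤ → A} (h : EqOnLongIntervals x y)
    {a b : ℤ} (hx : x ∈ layer τ a) (hy : y ∈ layer τ b) : (layer τ a ∩ layer τ b).Nonempty := by
  let _ : TopologicalSpace A := ⊥
  have : DiscreteTopology A := ⟨rfl⟩
  obtain ⟨z, hz⟩ := exists_mem_diag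
    (K := ⋃ t : Fin p, layer τ (t : ℕ) ×ˢ layer τ ((t : ℕ) + (b - a)))
    (isClosed_iUnion_of_finite fun t => (isClosed_layer _).prod (isClosed_layer _)) fun N => by
      obtain ⟨m, hm⟩ := h (2 * N)
      have hmod : a + (m + N) ≡ (lowDigit p (a + (m + N)) : ℕ) [ZMOD p] := by
        simp [coe_lowDigit, Int.ModEq]
      refine ⟨(shiftPow (m + N) x, shiftPow (m + N) y),
        Set.mem_iUnion.2 ⟨lowDigit p (a + (m + N)), ?_, ?_⟩, fun i hi => hm ?_⟩
      · exact layer_congr hmod ▸ shiftPow_mem_layer hx (m + N)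
      · rw [← layer_congr (hmod.add_right _), show a + (m + N) + (b - a) = b + (m + N) by ring]
        exact shiftPow_mem_layer hy (m + N)
      · obtain ⟨hi₁, hi₂⟩ := hi
        exact ⟨by omega, by push_cast; omega⟩
  obtain ⟨t, hza, hzb⟩ := Set.mem_iUnion.1 hz
  refine ⟨shiftPow (a - (t : ℕ)) z, ?_, ?_⟩
  · simpa using shiftPow_mem_layer hza (a - (t : ℕ))
  · rw [show b = (t : ℕ) + (b - a) + (a - (t : ℕ)) by ring]
    exact shiftPow_mem_layer hzb _

theorem IsLastDiff.mem_layer (hprim : IsPrimitive τ) {x y : ℤ → A} {r j : ℤ}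
    (hxy : IsLastDiff x y r) (hx : x ∈ layer τ j) (hy : y ∈ substShift τ) : y ∈ layer τ j := by
  obtain ⟨t, ht⟩ := exists_mem_layer hprim hy
  rwa [layer_eq_of_inter_nonempty hprim (hxy.eqOnLongIntervals.layer_inter_nonempty hx ht)]

/-- The pairs of letters which stand at the last coordinate where two sequences of `X` differ. -/
def lastDiffPairs (X : Set (ℤ → A)) : Set (A × A) :=
  {q | ∃ x ∈ X, ∃ y ∈ X, ∃ r, IsLastDiff x y r ∧ (x r, y r) = q}

theorem IsLastDiff.exists_mem_lastDiffPairs (hinj : Function.Injective τ) (hprim : IsPrimitive τ)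
    {x y : ℤ → A} {r j : ℤ} (hxy : IsLastDiff x y r) (hx : x ∈ layer τ j)
    (hy : y ∈ substShift τ) :
    ∃ c ∈ lastDiffPairs (substShift τ), IsLastDiff (τ c.1) (τ c.2) (lowDigit p (r + j)) ∧
      (τ c.1 (lowDigit p (r + j)), τ c.2 (lowDigit p (r + j))) = (x r, y r) := by
  obtain ⟨v, hv, hvy⟩ := hxy.mem_layer hprim hx hy
  obtain ⟨u, hu, hux⟩ := hx
  have hlift : IsLastDiff (seqMap τ u) (seqMap τ v) (r + j) := by
    simpa [hux, hvy] using hxy.shiftPow (-j)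
  refine ⟨(u ((r + j) / p), v ((r + j) / p)), ⟨u, hu, v, hv, _, hlift.of_seqMap hinj, rfl⟩,
    hlift.apply_of_seqMap, ?_⟩
  change (seqMap τ u (r + j), seqMap τ v (r + j)) = (x r, y r)
  simp [hux, hvy, Subst.shiftPow]

theorem leftUnique_of_rightUnique_of_rightTotal {P : Type*} [Finite P] {R : P → P → Prop}
    (hunique : Relator.RightUnique R) (htotal : Relator.RightTotal R) : Relator.LeftUnique R := by
  choose g hg using htotal
  have hg_surj : g.Surjective := Finite.surjective_of_injective fun b c hbc =>
    hunique (hg b) (hbc ▸ hg c)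
  intro a b c hac hbc
  obtain ⟨a, rfl⟩ := hg_surj a
  obtain ⟨b, rfl⟩ := hg_surj b
  rw [hunique (hg a) hac, hunique (hg b) hbc]

theorem eq_of_isLastDiff_of_isLastDiff (hinj : Function.Injective τ) (hprim : IsPrimitive τ)
    {c d q : A × A} (hc : c ∈ lastDiffPairs (substShift τ)) (hd : d ∈ lastDiffPairs (substShift τ))
    (hq : q ∈ lastDiffPairs (substShift τ)) {s t : Fin p} (hs : IsLastDiff (τ c.1) (τ c.2) s)
    (hcq : (τ c.1 s, τ c.2 s) = q) (ht : IsLastDiff (τ d.1) (τ d.2) t)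
    (hdq : (τ d.1 t, τ d.2 t) = q) : c = d := by
  let R (c q : lastDiffPairs (substShift τ)) : Prop :=
    ∃ t, IsLastDiff (τ c.1.1) (τ c.1.2) t ∧ (τ c.1.1 t, τ c.1.2 t) = q.1
  have hunique : Relator.RightUnique R := by
    rintro c q q' ⟨s, hs, hq⟩ ⟨t, ht, hq'⟩
    obtain rfl := hs.unique ht
    exact Subtype.ext (hq.symm.trans hq')
  have htotal : Relator.RightTotal R := by
    rintro ⟨q, x, hx, y, hy, r, hxy, rfl⟩
    obtain ⟨j, hj⟩ := exists_mem_layer hprim hx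
    obtain ⟨c, hc, hlast, hcq⟩ := hxy.exists_mem_lastDiffPairs hinj hprim hj hy
    exact ⟨⟨c, hc⟩, _, hlast, hcq⟩
  exact congrArg Subtype.val <| leftUnique_of_rightUnique_of_rightTotal hunique htotal
    (a := ⟨c, hc⟩) (b := ⟨d, hd⟩) (c := ⟨q, hq⟩) ⟨s, hs, hcq⟩ ⟨t, ht, hdq⟩

theorem modEq_of_mem_layer (hinj : Function.Injective τ) (hprim : IsPrimitive τ)
    (hinf : (substShift τ).Infinite) {x : ℤ → A} {a b : ℤ} (ha : x ∈ layer τ a)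
    (hb : x ∈ layer τ b) : a ≡ b [ZMOD p] := by
  let _ : TopologicalSpace A := ⊥
  have : DiscreteTopology A := ⟨rfl⟩
  obtain ⟨u, hu, v, hv, r, huv⟩ :=
    exists_isLastDiff (isClosed_substShift τ) (fun _ => shiftPow_mem_substShift) hinf
  obtain ⟨j, hj⟩ := exists_mem_layer hprim hu
  have hj' : u ∈ layer τ ((j : ℕ) + (b - a)) := by
    have hab := layer_eq_of_inter_nonempty hprim ⟨x, ha, hb⟩
    rw [show ((j : ℕ) : ℤ) + (b - a) = b + ((j : ℕ) - a) by ring, layer_add, ← hab, ← layer_add]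
    simpa using hj
  obtain ⟨c, hc, hlast, hcu⟩ := huv.exists_mem_lastDiffPairs hinj hprim hj hv
  obtain ⟨d, hd, hlast', hdu⟩ := huv.exists_mem_lastDiffPairs hinj hprim hj' hv
  obtain rfl := eq_of_isLastDiff_of_isLastDiff hinj hprim hc hd ⟨u, hu, v, hv, r, huv, rfl⟩
    hlast hcu hlast' hdu
  have hmod : r + (j : ℕ) ≡ r + ((j : ℕ) + (b - a)) [ZMOD p] :=
    lowDigit_eq_iff.1 (hlast.unique hlast')
  simpa [Int.modEq_iff_dvd] using hmod

end Layers

section Recognizable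

variable {A : Type*} {p : ℕ} [NeZero p] {τ : A → Fin p → A}

variable (τ) in
/-- Recognizability: every point of `X_τ` is cut into images of letters in exactly one way, as far
as the positions of the images are concerned. -/
def IsRecognizable : Prop := ∀ x ∈ substShift τ, ∃! t : Fin p, x ∈ layer τ (t : ℕ)

theorem isRecognizable [Finite A] (hinj : Function.Injective τ) (hprim : IsPrimitive τ)
    (hinf : (substShift τ).Infinite) : IsRecognizable τ := fun x hx => by
  obtain ⟨t, ht⟩ := exists_mem_layer hprim hx
  refine ⟨t, ht, fun s hs => ?_⟩
  rw [← lowDigit_natCast s, ← lowDigit_natCast t, lowDigit_eq_iff]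
  exact modEq_of_mem_layer hinj hprim hinf hs ht

theorem IsRecognizable.eq (hτ : IsRecognizable τ) {x : ℤ → A} {s t : Fin p}
    (hs : x ∈ layer τ (s : ℕ)) (ht : x ∈ layer τ (t : ℕ)) : s = t :=
  (hτ x (mem_substShift_of_mem_layer hs)).unique hs ht

end Recognizable

/-! ### Expansions -/

section Expansion

variable {A : Type*} {p : ℕ} [NeZero p] {τ : A → Fin p → A} {x : ℤ → A} {z : ℕ → ℤ → A}
  {δ : ℕ → Fin p}

theorem IsExpansion.mem_layer (h : IsExpansion τ x z δ) (n : ℕ) : z n ∈ layer τ (δ n : ℕ) :=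
  ⟨z (n + 1), h.2.1 (n + 1), h.2.2 n⟩

theorem IsExpansion.apply (h : IsExpansion τ x z δ) (n : ℕ) (m : ℤ) :
    z n m = seqMap τ (z (n + 1)) (m + (δ n : ℕ)) := by
  rw [h.2.2 n, shiftPow, add_neg_cancel_right]

theorem IsRecognizable.exists_isExpansion (hτ : IsRecognizable τ) (hx : x ∈ substShift τ) :
    ∃ q : (ℕ → ℤ → A) × (ℕ → Fin p), IsExpansion τ x q.1 q.2 := by
  have hdesub (y : substShift τ) : ∃ (t : Fin p) (u : substShift τ),
      seqMap τ u.1 = shiftPow (-((t : ℕ) : ℤ)) y.1 := by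
    obtain ⟨t, ⟨u, hu, huy⟩, -⟩ := hτ y.1 y.2
    exact ⟨t, ⟨u, hu⟩, huy⟩
  choose t u htu using hdesub
  refine ⟨(fun n => (u^[n] ⟨x, hx⟩).1, fun n => t (u^[n] ⟨x, hx⟩)), rfl,
    fun n => (u^[n] ⟨x, hx⟩).2, fun n => ?_⟩
  simp only [Function.iterate_succ_apply', htu]

theorem IsRecognizable.isExpansion (hτ : IsRecognizable τ) (hx : x ∈ substShift τ) :
    IsExpansion τ x (desub τ x) (odometerMap τ x) := by
  have h := hτ.exists_isExpansion hx
  have hchoose : expansion τ x = h.choose := dif_pos h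
  change IsExpansion τ x (expansion τ x).1 (expansion τ x).2
  exact hchoose ▸ h.choose_spec

theorem IsExpansion.unique (h : IsExpansion τ x z δ) (hinj : Function.Injective τ)
    (hτ : IsRecognizable τ) {w : ℕ → ℤ → A} {ε : ℕ → Fin p} (h' : IsExpansion τ x w ε) :
    z = w ∧ δ = ε := by
  have hdigit {n : ℕ} (hn : z n = w n) : δ n = ε n :=
    hτ.eq (h.mem_layer n) (hn ▸ h'.mem_layer n)
  have hzw (n : ℕ) : z n = w n := by
    induction n with
    | zero => rw [h.1, h'.1]
    | succ n ih => exact seqMap_injective hinj (by rw [h.2.2, h'.2.2, hdigit ih, ih])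
  exact ⟨funext hzw, funext fun n => hdigit (hzw n)⟩

end Expansion

/-! ### Carries -/

section Carry

variable {p : ℕ} {δ : ℕ → Fin p} {k : ℤ} {n : ℕ}

/-- The carries of the addition of the integer `k` to the point of the `p`-odometer with the digits
`δ`; the carry into the lowest digit is `k` itself. -/
def carry (δ : ℕ → Fin p) (k : ℤ) : ℕ → ℤ
  | 0 => k
  | n + 1 => (carry δ k n + (δ n : ℕ)) / p

/-- The length of `x_0 s_0(x) τ(s_1(x)) ⋯ τ^(n-1)(s_(n-1)(x))` for a point `x` with the digits
`δ`. -/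
def rightLength (δ : ℕ → Fin p) (n : ℕ) : ℕ :=
  1 + ∑ j ∈ Finset.range n, (p - 1 - (δ j : ℕ)) * p ^ j

theorem rightLength_succ (δ : ℕ → Fin p) (n : ℕ) :
    rightLength δ (n + 1) = rightLength δ n + (p - 1 - (δ n : ℕ)) * p ^ n := by
  rw [rightLength, rightLength, Finset.sum_range_succ, add_assoc]

theorem monotone_rightLength (δ : ℕ → Fin p) : Monotone (rightLength δ) :=
  monotone_nat_of_le_succ fun n => by simp [rightLength_succ]

theorem tendsto_rightLength (hδ : ∃ᶠ n in atTop, (δ n : ℕ) + 1 < p) :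
    Tendsto (rightLength δ) atTop atTop := by
  refine tendsto_atTop_atTop_of_monotone (monotone_rightLength δ) fun b => ?_
  obtain ⟨n, hbn, hn⟩ := frequently_atTop.1 hδ b
  refine ⟨n + 1, ?_⟩
  calc b ≤ n := hbn
    _ ≤ p ^ n := (Nat.lt_pow_self (by omega)).le
    _ ≤ (p - 1 - (δ n : ℕ)) * p ^ n := Nat.le_mul_of_pos_left _ (by omega)
    _ ≤ rightLength δ (n + 1) := by rw [rightLength_succ]; exact Nat.le_add_left _ _

variable [NeZero p]

theorem le_carry_iff {c : ℤ} : c ≤ carry δ k n ↔ rightLength δ n + (c - 1) * p ^ n ≤ k := by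
  induction n generalizing c with
  | zero => simp [carry, rightLength]
  | succ n ih =>
    have hdigit : ((p - 1 - (δ n : ℕ) : ℕ) : ℤ) = p - 1 - (δ n : ℕ) := by omega
    have hsum : (rightLength δ (n + 1) : ℤ) + (c - 1) * p ^ (n + 1) =
        rightLength δ n + (c * p - (δ n : ℕ) - 1) * p ^ n := by
      rw [rightLength_succ]
      push_cast [hdigit]
      ring
    rw [carry, Int.le_ediv_iff_mul_le (natCast_pos p), ← sub_le_iff_le_add, ih, hsum]

theorem one_le_carry_iff : 1 ≤ carry δ k n ↔ rightLength δ n ≤ k := by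
  rw [le_carry_iff, sub_self, zero_mul, add_zero]

theorem carry_rightLength (δ : ℕ → Fin p) (n : ℕ) : carry δ (rightLength δ n) n = 1 := by
  refine le_antisymm (Int.lt_add_one_iff.1 (not_le.1 fun h => ?_)) (one_le_carry_iff.2 le_rfl)
  have hpow : (0 : ℤ) < p ^ n := pow_pos (natCast_pos p) n
  linarith [le_carry_iff.1 h]

omit [NeZero p] in
theorem carry_nonneg (hk : 0 ≤ k) (n : ℕ) : 0 ≤ carry δ k n := by
  induction n with
  | zero => exact hk
  | succ n ih => exact Int.ediv_nonneg (by omega) (by omega)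

theorem eventually_carry_eq_zero (hδ : ∃ᶠ n in atTop, (δ n : ℕ) + 1 < p) (hk : 0 ≤ k) :
    ∀ᶠ n in atTop, carry δ k n = 0 := by
  filter_upwards [(tendsto_rightLength hδ).eventually_gt_atTop k.toNat] with n hn
  have hlt : ¬ 1 ≤ carry δ k n := by rw [one_le_carry_iff]; omega
  have := carry_nonneg (δ := δ) hk n
  omega

/-- The digits of the sum of the integer `k` and the point of the `p`-odometer with the digits
`δ`. -/
def addDigits (δ : ℕ → Fin p) (k : ℤ) (n : ℕ) : Fin p :=
  lowDigit p (carry δ k n + (δ n : ℕ))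

theorem mul_carry_add_addDigits (δ : ℕ → Fin p) (k : ℤ) (n : ℕ) :
    p * carry δ k (n + 1) + (addDigits δ k n : ℕ) = carry δ k n + (δ n : ℕ) :=
  mul_ediv_add_lowDigit p _

theorem frequently_addDigits_lt (hδ : ∃ᶠ n in atTop, (δ n : ℕ) + 1 < p) (hk : 0 ≤ k) :
    ∃ᶠ n in atTop, (addDigits δ k n : ℕ) + 1 < p := by
  have hcarry := eventually_carry_eq_zero hδ hk
  refine (hδ.and_eventually (hcarry.and ((tendsto_add_atTop_nat 1).eventually hcarry))).mono ?_
  rintro n ⟨hn, h₀, h₁⟩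
  have := mul_carry_add_addDigits δ k n
  rw [h₁, h₀] at this
  omega

theorem eventually_addDigits_rightLength_eq_zero {N : ℕ} (hδ : ∀ n ≥ N, (δ n : ℕ) + 1 = p) :
    ∀ᶠ n in atTop, (addDigits δ (rightLength δ N) n : ℕ) = 0 := by
  have hlength (n : ℕ) (hn : N ≤ n) : rightLength δ n = rightLength δ N := by
    induction n, hn using Nat.le_induction with
    | base => rfl
    | succ n hn ih =>
      have hzero : p - 1 - (δ n : ℕ) = 0 := by have := hδ n hn; omega
      rw [rightLength_succ, hzero, zero_mul, add_zero, ih]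
  have hcarry (n : ℕ) (hn : N ≤ n) : carry δ (rightLength δ N) n = 1 := by
    rw [← hlength n hn, carry_rightLength]
  filter_upwards [eventually_ge_atTop N] with n hn
  have hsum := mul_carry_add_addDigits δ (rightLength δ N) n
  rw [hcarry n hn, hcarry (n + 1) (by omega)] at hsum
  have := hδ n hn
  omega

end Carry

/-! ### The words `s_i` -/

section Words

variable {A : Type*} {p : ℕ} [NeZero p] {τ : A → Fin p → A} {x y : ℤ → A} {z : ℕ → ℤ → A}
  {δ : ℕ → Fin p}

theorem IsExpansion.shiftPow (h : IsExpansion τ x z δ) (k : ℤ) :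
    IsExpansion τ (shiftPow k x) (fun n => shiftPow (carry δ k n) (z n)) (addDigits δ k) := by
  refine ⟨by simp only [carry, h.1], fun n => shiftPow_mem_substShift (h.2.1 n) _, fun n => ?_⟩
  have hsum := mul_carry_add_addDigits δ k n
  simp only [seqMap_shiftPow, h.2.2, shiftPow_add]
  congr 1
  omega

theorem IsRecognizable.odometerMap_shiftPow (hτ : IsRecognizable τ) (hinj : Function.Injective τ)
    (hx : x ∈ substShift τ) (k : ℤ) :
    odometerMap τ (shiftPow k x) = addDigits (odometerMap τ x) k :=
  ((hτ.isExpansion (shiftPow_mem_substShift hx k)).unique hinj hτ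
    ((hτ.isExpansion hx).shiftPow k)).2

theorem IsRecognizable.odometerMap_shiftPow_congr (hτ : IsRecognizable τ)
    (hinj : Function.Injective τ) (hx : x ∈ substShift τ) (hy : y ∈ substShift τ)
    (hxy : odometerMap τ x = odometerMap τ y) (k : ℤ) :
    odometerMap τ (shiftPow k x) = odometerMap τ (shiftPow k y) := by
  rw [hτ.odometerMap_shiftPow hinj hx, hτ.odometerMap_shiftPow hinj hy, hxy]

theorem mem_iPlus {n : ℕ} : n ∈ iPlus τ x ↔ (odometerMap τ x n : ℕ) + 1 < p := by
  simp only [iPlus, sWord, Set.mem_ofPred_eq, length_subword]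
  omega

theorem iPlus_congr (h : odometerMap τ x = odometerMap τ y) : iPlus τ x = iPlus τ y := by
  ext n
  rw [mem_iPlus, mem_iPlus, h]

theorem infinite_iPlus_iff :
    (iPlus τ x).Infinite ↔ ∃ᶠ n in atTop, (odometerMap τ x n : ℕ) + 1 < p := by
  simp only [← mem_iPlus, Nat.frequently_atTop_iff_infinite, Set.ofPred_mem_eq]

theorem length_rightWord (x : ℤ → A) (n : ℕ) :
    (rightWord τ x n).length = rightLength (odometerMap τ x) (n + 1) := by
  simp only [rightWord, List.length_cons, List.length_flatMap, length_wordMap_iterate, sWord,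
    length_subword, rightLength, add_comm]
  rfl

theorem kPlus_congr (h : odometerMap τ x = odometerMap τ y) : kPlus τ x = kPlus τ y := by
  simp only [kPlus, length_rightWord, h, iPlus_congr h]

theorem kPlus_eq_rightLength {N : ℕ} (hN : ∀ n ∈ iPlus τ x, n < N) :
    kPlus τ x = rightLength (odometerMap τ x) N := by
  refine IsGreatest.csSup_eq ⟨?_, ?_⟩
  · clear hN
    induction N with
    | zero => exact Or.inl rfl
    | succ n ih =>
      by_cases hn : n ∈ iPlus τ x
      · exact Or.inr ⟨n, hn, (length_rightWord x n).symm⟩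
      · rw [mem_iPlus] at hn
        rwa [rightLength_succ, show p - 1 - (odometerMap τ x n : ℕ) = 0 by omega, zero_mul,
          add_zero]
  · rintro _ (rfl | ⟨n, hn, rfl⟩)
    · exact Nat.le_add_right _ _
    · rw [length_rightWord]
      exact monotone_rightLength _ (hN n hn)

theorem IsRecognizable.infinite_iPlus_shiftPow (hτ : IsRecognizable τ)
    (hinj : Function.Injective τ) (hx : x ∈ substShift τ) (hinf : (iPlus τ x).Infinite) {k : ℤ}
    (hk : 0 ≤ k) : (iPlus τ (Subst.shiftPow k x)).Infinite := by
  rw [infinite_iPlus_iff] at hinf ⊢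
  rw [hτ.odometerMap_shiftPow hinj hx]
  exact frequently_addDigits_lt hinf hk

theorem IsRecognizable.infinite_iPlus_shiftPow_kPlus (hτ : IsRecognizable τ)
    (hinj : Function.Injective τ) (hp : 2 ≤ p) (hx : x ∈ substShift τ)
    (hfin : (iPlus τ x).Finite) : (iPlus τ (Subst.shiftPow (kPlus τ x) x)).Infinite := by
  obtain ⟨N, hN⟩ := hfin.bddAbove
  have hlast (n : ℕ) (hn : N + 1 ≤ n) : (odometerMap τ x n : ℕ) + 1 = p := by
    have hmem : ¬ n ∈ iPlus τ x := fun h => by have := hN h; omega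
    rw [mem_iPlus] at hmem
    omega
  rw [infinite_iPlus_iff, hτ.odometerMap_shiftPow hinj hx,
    kPlus_eq_rightLength fun n hn => Nat.lt_succ_of_le (hN hn)]
  refine ((eventually_addDigits_rightLength_eq_zero hlast).mono fun n hn => ?_).frequently
  rw [Nat.succ_eq_add_one, hn]
  omega

end Words

/-! ### Distances along the orbits -/

section Dist

variable {A : Type*} {X : Set (ℤ → A)} {x y : ℤ → A}

theorem seqDist_nonneg (x y : ℤ → A) : 0 ≤ seqDist x y := by
  unfold seqDist
  split_ifs <;> positivity

theorem seqDist_le {N : ℕ} (h : ∀ i : ℤ, i.natAbs < N → x i = y i) :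
    seqDist x y ≤ (1 / 2 : ℝ) ^ N := by
  unfold seqDist
  split_ifs with hxy
  · positivity
  · obtain ⟨i, hi⟩ := Function.ne_iff.1 hxy
    refine pow_le_pow_of_le_one (by norm_num) (by norm_num) (le_csInf ⟨_, i, rfl, hi⟩ ?_)
    rintro _ ⟨j, rfl, hj⟩
    exact not_lt.1 fun hlt => hj (h j hlt)

theorem le_seqDist {i : ℤ} (h : x i ≠ y i) : (1 / 2 : ℝ) ^ i.natAbs ≤ seqDist x y := by
  rw [seqDist, if_neg fun hxy => h (congrFun hxy i)]
  exact pow_le_pow_of_le_one (by norm_num) (by norm_num) (Nat.sInf_le ⟨i, rfl, h⟩)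

theorem seqDist_le_one (x y : ℤ → A) : seqDist x y ≤ 1 := by
  simpa using seqDist_le (x := x) (y := y) (N := 0) (by simp)

theorem one_le_seqDist_shift_iterate {n : ℕ} (h : x n ≠ y n) :
    1 ≤ seqDist (shift^[n] x) (shift^[n] y) := by
  simpa using le_seqDist (x := shift^[n] x) (y := shift^[n] y) (i := 0)
    (by simpa [shift_iterate, shiftPow] using h)

theorem mem_asymptoticPairs_iff_eventuallyEq (hx : x ∈ X) (hy : y ∈ X) :
    (x, y) ∈ asymptoticPairs X seqDist shift ↔ x =ᶠ[atTop] y := by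
  refine ⟨fun h => ?_, fun h => ⟨hx, hy, ?_⟩⟩
  · rw [EventuallyEq, ← Nat.map_cast_int_atTop, eventually_map]
    filter_upwards [h.2.2.eventually_lt_const one_pos] with n hn
    by_contra hne
    exact hn.not_ge (one_le_seqDist_shift_iterate hne)
  · obtain ⟨M, hM⟩ := eventually_atTop.1 h
    have hpow : Tendsto (fun n : ℕ => (1 / 2 : ℝ) ^ (n - M.toNat)) atTop (𝓝 0) :=
      (tendsto_pow_atTop_nhds_zero_of_lt_one (by norm_num) (by norm_num)).comp
        (tendsto_sub_atTop_nat M.toNat)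
    refine squeeze_zero (fun n => seqDist_nonneg _ _) (fun n => seqDist_le fun i hi => ?_) hpow
    simp only [shift_iterate]
    exact hM _ (by omega)

theorem mem_distalPairs_of_eventually_ne (hx : x ∈ X) (hy : y ∈ X)
    (h : ∀ᶠ m in atTop, x m ≠ y m) : (x, y) ∈ distalPairs X seqDist shift := by
  rw [← Nat.map_cast_int_atTop, eventually_map] at h
  have hdist : (fun n : ℕ => seqDist (shift^[n] x) (shift^[n] y)) =ᶠ[atTop] fun _ => (1 : ℝ) :=
    h.mono fun n hn => (seqDist_le_one _ _).antisymm (one_le_seqDist_shift_iterate hn)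
  refine ⟨hx, hy, ?_⟩
  rw [liminf_congr hdist, liminf_const]
  exact one_pos

theorem eqOnLongIntervals_of_mem_proximalPairs (h : (x, y) ∈ proximalPairs X seqDist shift) :
    EqOnLongIntervals x y := fun N => by
  have hfreq : ∃ᶠ n : ℕ in atTop, seqDist (shift^[n] x) (shift^[n] y) < (1 / 2 : ℝ) ^ N :=
    frequently_lt_of_liminf_lt
      (isBoundedUnder_of ⟨1, fun n => seqDist_le_one _ _⟩).isCoboundedUnder_ge
      (h.2.2.trans_lt (by positivity))
  obtain ⟨n, hn⟩ := hfreq.exists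
  refine ⟨n, fun m hm => ?_⟩
  by_contra hne
  have hle := le_seqDist (x := shift^[n] x) (y := shift^[n] y) (i := m - n)
    (by simpa [shift_iterate, shiftPow] using hne)
  have hpow : (1 / 2 : ℝ) ^ N ≤ (1 / 2) ^ (m - n).natAbs :=
    pow_le_pow_of_le_one (by norm_num) (by norm_num) (by have := hm.1; have := hm.2; omega)
  linarith

theorem eventuallyEq_shiftPow_iff (k : ℤ) :
    shiftPow k x =ᶠ[atTop] shiftPow k y ↔ x =ᶠ[atTop] y := by
  change (∀ᶠ m in atTop, x (m + k) = y (m + k)) ↔ _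
  rw [EventuallyEq, ← eventually_map (m := fun m : ℤ => m + k) (P := fun m => x m = y m)]
  rw [show map (fun m : ℤ => m + k) atTop = atTop from (OrderIso.addRight k).map_atTop]

end Dist

/-! ### Points with the same digits -/

section Fibre

variable {A : Type*} {p : ℕ} [NeZero p] {τ : A → Fin p → A} {x y : ℤ → A} {z w : ℕ → ℤ → A}
  {δ : ℕ → Fin p}

theorem apply_eq_iff_seqMap (hinj : Function.Injective τ) (u v : ℤ → A) (c : ℤ) :
    u c = v c ↔ ∀ m : ℤ, m / p = c → seqMap τ u m = seqMap τ v m := by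
  refine ⟨fun h m hm => by simp only [seqMap, hm, h], fun h => hinj (funext fun t => ?_)⟩
  simpa only [seqMap_apply] using h _ (mul_add_ediv c t)

theorem seqMap_apply_eq_iff (hcoinc : ¬ HasCoincidence τ) (u v : ℤ → A) (m : ℤ) :
    seqMap τ u m = seqMap τ v m ↔ u (m / p) = v (m / p) :=
  ⟨fun h => by_contra fun hne => hcoinc ⟨_, _, hne, _, h⟩, fun h => by simp only [seqMap, h]⟩

theorem IsExpansion.apply_eq_iff (hz : IsExpansion τ x z δ) (hw : IsExpansion τ y w δ)
    (hinj : Function.Injective τ) {n : ℕ} {c : ℤ} :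
    z n c = w n c ↔ ∀ m, carry δ m n = c → x m = y m := by
  induction n generalizing c with
  | zero => simp [hz.1, hw.1, carry]
  | succ n ih =>
    calc z (n + 1) c = w (n + 1) c
        ↔ ∀ d : ℤ, d / p = c → seqMap τ (z (n + 1)) d = seqMap τ (w (n + 1)) d :=
          apply_eq_iff_seqMap hinj _ _ _
      _ ↔ ∀ d : ℤ, (d + (δ n : ℕ)) / p = c → z n d = w n d := by
          simp only [hz.apply n, hw.apply n]
          exact ((Equiv.addRight ((δ n : ℕ) : ℤ)).forall_congr_right (q := fun d => d / p = c →
            seqMap τ (z (n + 1)) d = seqMap τ (w (n + 1)) d)).symm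
      _ ↔ ∀ m, carry δ m (n + 1) = c → x m = y m := by
          simp only [ih, carry]
          exact ⟨fun h m hm => h _ hm m rfl, fun h d hd m hm => h m (hm ▸ hd)⟩

theorem IsExpansion.apply_carry_eq_iff (hz : IsExpansion τ x z δ) (hw : IsExpansion τ y w δ)
    (hcoinc : ¬ HasCoincidence τ) (m : ℤ) (n : ℕ) :
    z n (carry δ m n) = w n (carry δ m n) ↔ x m = y m := by
  induction n with
  | zero => rw [hz.1, hw.1, carry]
  | succ n ih => rw [← ih, hz.apply n, hw.apply n, seqMap_apply_eq_iff hcoinc, carry]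

theorem IsExpansion.forall_apply_ne (hz : IsExpansion τ x z δ) (hw : IsExpansion τ y w δ)
    (hcoinc : ¬ HasCoincidence τ) (hδ : ∃ᶠ n in atTop, (δ n : ℕ) + 1 < p) (h : x 0 ≠ y 0) {m : ℤ}
    (hm : 0 ≤ m) : x m ≠ y m := by
  obtain ⟨n, hn₀, hnm⟩ :=
    ((eventually_carry_eq_zero hδ le_rfl).and (eventually_carry_eq_zero hδ hm)).exists
  rwa [Ne, ← hz.apply_carry_eq_iff hw hcoinc m n, hnm, ← hn₀, hz.apply_carry_eq_iff hw hcoinc]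

theorem IsExpansion.eventually_eqOn_Ici_one (hz : IsExpansion τ x z δ) (hw : IsExpansion τ y w δ)
    (hinj : Function.Injective τ) (hδ : ∃ᶠ n in atTop, (δ n : ℕ) + 1 < p) (h : x =ᶠ[atTop] y) :
    ∀ᶠ n in atTop, Set.EqOn (z n) (w n) (Set.Ici 1) := by
  obtain ⟨M, hM⟩ := eventually_atTop.1 h
  filter_upwards [(tendsto_rightLength hδ).eventually_ge_atTop M.toNat] with n hn c hc
  refine (hz.apply_eq_iff hw hinj).2 fun m hm => hM m ?_
  have := one_le_carry_iff.1 (hm ▸ hc : 1 ≤ carry δ m n)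
  omega

theorem exists_carry_mem_Ico (hδ : ∃ᶠ n in atTop, (δ n : ℕ) + 1 < p) {N : ℕ} {m : ℤ}
    (hm : rightLength δ N ≤ m) :
    ∃ n ≥ N, carry δ m n ∈ Set.Ico 1 (1 + ((p - 1 - (δ n : ℕ) : ℕ) : ℤ)) := by
  obtain ⟨n, hn, hle, hlt⟩ : ∃ n ≥ N, rightLength δ n ≤ m ∧ m < rightLength δ (n + 1) := by
    by_contra! hstep
    have hle (n : ℕ) (hn : N ≤ n) : (rightLength δ n : ℤ) ≤ m := by
      induction n, hn using Nat.le_induction with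
      | base => exact hm
      | succ n hn ih => exact hstep n hn ih
    obtain ⟨n, hgt, hn⟩ := (((tendsto_rightLength hδ).eventually_gt_atTop m.toNat).and
      (eventually_ge_atTop N)).exists
    have := hle n hn
    omega
  have hcarry : carry δ m (n + 1) < 1 := by
    rw [← not_le, one_le_carry_iff]
    omega
  rw [carry, Int.ediv_lt_iff_lt_mul (natCast_pos p)] at hcarry
  exact ⟨n, hn, one_le_carry_iff.2 hle, by omega⟩

theorem IsExpansion.eventuallyEq_of_eqOn_Ico (hz : IsExpansion τ x z δ)
    (hw : IsExpansion τ y w δ) (hinj : Function.Injective τ)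
    (hδ : ∃ᶠ n in atTop, (δ n : ℕ) + 1 < p)
    (h : ∀ᶠ n in atTop, Set.EqOn (z n) (w n) (Set.Ico 1 (1 + ((p - 1 - (δ n : ℕ) : ℕ) : ℤ)))) :
    x =ᶠ[atTop] y := by
  obtain ⟨N, hN⟩ := eventually_atTop.1 h
  filter_upwards [eventually_ge_atTop (rightLength δ N : ℤ)] with m hm
  obtain ⟨n, hn, hcarry⟩ := exists_carry_mem_Ico hδ hm
  exact (hz.apply_eq_iff hw hinj).1 (hN n hn hcarry) m rfl

theorem sWord_eq_iff (hxy : odometerMap τ x = odometerMap τ y) {n : ℕ} :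
    sWord τ x n = sWord τ y n ↔ Set.EqOn (desub τ x n) (desub τ y n)
      (Set.Ico 1 (1 + ((p - 1 - (odometerMap τ x n : ℕ) : ℕ) : ℤ))) := by
  rw [sWord, sWord, ← hxy, subword_eq_iff]

theorem IsRecognizable.eventuallyEq_iff (hτ : IsRecognizable τ) (hinj : Function.Injective τ)
    (hx : x ∈ substShift τ) (hy : y ∈ substShift τ) (hxy : odometerMap τ x = odometerMap τ y)
    (hinf : (iPlus τ x).Infinite) :
    x =ᶠ[atTop] y ↔ ∀ᶠ n in atTop, sWord τ x n = sWord τ y n := by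
  have hz := hτ.isExpansion hx
  have hw := hxy ▸ hτ.isExpansion hy
  rw [infinite_iPlus_iff] at hinf
  simp only [sWord_eq_iff hxy]
  refine ⟨fun h => ?_, hz.eventuallyEq_of_eqOn_Ico hw hinj hinf⟩
  exact (hz.eventually_eqOn_Ici_one hw hinj hinf h).mono fun n hn =>
    hn.mono Set.Ico_subset_Ici_self

theorem IsRecognizable.mem_asymptoticPairs_iff (hτ : IsRecognizable τ)
    (hinj : Function.Injective τ) (hp : 2 ≤ p) (hx : x ∈ substShift τ) (hy : y ∈ substShift τ)
    (hxy : odometerMap τ x = odometerMap τ y) :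
    (x, y) ∈ asymptoticPairs (substShift τ) seqDist shift ↔
      ((iPlus τ x).Infinite ∧ ∀ᶠ n in atTop, sWord τ x n = sWord τ y n) ∨
      ((iPlus τ x).Finite ∧ ∀ᶠ n in atTop,
        sWord τ (shiftPow (kPlus τ x) x) n = sWord τ (shiftPow (kPlus τ x) y) n) := by
  rw [mem_asymptoticPairs_iff_eventuallyEq hx hy]
  by_cases hfin : (iPlus τ x).Finite
  · rw [← eventuallyEq_shiftPow_iff (kPlus τ x : ℤ),
      hτ.eventuallyEq_iff hinj (shiftPow_mem_substShift hx _) (shiftPow_mem_substShift hy _)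
        (hτ.odometerMap_shiftPow_congr hinj hx hy hxy _)
        (hτ.infinite_iPlus_shiftPow_kPlus hinj hp hx hfin)]
    simp only [hfin, Set.Infinite, not_true_eq_false, false_and, true_and, false_or]
  · rw [hτ.eventuallyEq_iff hinj hx hy hxy hfin]
    simp only [hfin, Set.Infinite, not_false_eq_true, false_and, true_and, or_false]

theorem IsRecognizable.mem_distalPairs (hτ : IsRecognizable τ) (hinj : Function.Injective τ)
    (hcoinc : ¬ HasCoincidence τ) (hx : x ∈ substShift τ) (hy : y ∈ substShift τ)
    (hxy : odometerMap τ x = odometerMap τ y) {i : ℤ} (hi : x i ≠ y i)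
    (hinf : (iPlus τ (shiftPow i x)).Infinite) :
    (x, y) ∈ distalPairs (substShift τ) seqDist shift := by
  have hz := hτ.isExpansion (shiftPow_mem_substShift hx i)
  have hw := hτ.isExpansion (shiftPow_mem_substShift hy i)
  rw [← hτ.odometerMap_shiftPow_congr hinj hx hy hxy] at hw
  rw [infinite_iPlus_iff] at hinf
  refine mem_distalPairs_of_eventually_ne hx hy ((eventually_ge_atTop i).mono fun m hm => ?_)
  simpa [shiftPow] using hz.forall_apply_ne hw hcoinc hinf (by simpa [shiftPow] using hi)
    (sub_nonneg.2 hm)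

theorem IsRecognizable.mem_asymptoticPairs (hτ : IsRecognizable τ) (hinj : Function.Injective τ)
    (hp : 2 ≤ p) (hx : x ∈ substShift τ) (hy : y ∈ substShift τ)
    (h : ¬ ∃ i : ℤ, x i ≠ y i ∧ (iPlus τ (shiftPow i x)).Infinite) :
    (x, y) ∈ asymptoticPairs (substShift τ) seqDist shift := by
  obtain ⟨k, hk⟩ : ∃ k : ℤ, (iPlus τ (shiftPow k x)).Infinite := by
    by_cases hfin : (iPlus τ x).Finite
    · exact ⟨_, hτ.infinite_iPlus_shiftPow_kPlus hinj hp hx hfin⟩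
    · exact ⟨0, by rwa [shiftPow_zero]⟩
  rw [mem_asymptoticPairs_iff_eventuallyEq hx hy]
  refine (eventually_ge_atTop k).mono fun m hm => by_contra fun hne => h ⟨m, hne, ?_⟩
  simpa only [shiftPow_add, sub_add_cancel] using hτ.infinite_iPlus_shiftPow hinj
    (shiftPow_mem_substShift hx k) hk (sub_nonneg.2 hm)

end Fibre

section LiYorke

variable {A : Type*} {p : ℕ} [NeZero p] {τ : A → Fin p → A} {x y : ℤ → A}

theorem eqOnLongIntervals_of_seqMap (hinj : Function.Injective τ) {u v : ℤ → A}
    (h : EqOnLongIntervals (seqMap τ u) (seqMap τ v)) : EqOnLongIntervals u v := fun N => by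
  obtain ⟨m, hm⟩ := h (p * (N + 1))
  refine ⟨m / p + 1, fun c hc => (apply_eq_iff_seqMap hinj u v c).2 fun d hd => hm ?_⟩
  obtain ⟨hc₁, hc₂⟩ := hc
  have hmd : m / (p : ℤ) < d / p := by omega
  have hdm : d / (p : ℤ) < m / p + (N + 1) := by omega
  rw [Int.ediv_lt_iff_lt_mul (natCast_pos p)] at hmd hdm
  have := Int.ediv_mul_le m (natCast_pos p).ne'
  constructor
  · have := Int.ediv_mul_le d (natCast_pos p).ne'
    linarith
  · push_cast
    linarith

theorem EqOnLongIntervals.shiftPow (h : EqOnLongIntervals x y) (k : ℤ) :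
    EqOnLongIntervals (shiftPow k x) (shiftPow k y) := fun N => by
  obtain ⟨m, hm⟩ := h N
  exact ⟨m - k, fun i hi => hm ⟨by have := hi.1; omega, by have := hi.2; omega⟩⟩

theorem EqOnLongIntervals.odometerMap_eq [Finite A] (h : EqOnLongIntervals x y)
    (hτ : IsRecognizable τ) (hinj : Function.Injective τ) (hx : x ∈ substShift τ)
    (hy : y ∈ substShift τ) : odometerMap τ x = odometerMap τ y := by
  have hz := hτ.isExpansion hx
  have hw := hτ.isExpansion hy
  have hdigit {n : ℕ} (hn : EqOnLongIntervals (desub τ x n) (desub τ y n)) :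
      odometerMap τ x n = odometerMap τ y n := by
    obtain ⟨u, hux, huy⟩ := hn.layer_inter_nonempty (hz.mem_layer n) (hw.mem_layer n)
    exact hτ.eq hux huy
  have hdesub (n : ℕ) : EqOnLongIntervals (desub τ x n) (desub τ y n) := by
    induction n with
    | zero => rwa [hz.1, hw.1]
    | succ n ih =>
      refine eqOnLongIntervals_of_seqMap hinj ?_
      rw [hz.2.2, hw.2.2, hdigit ih]
      exact ih.shiftPow _
  exact funext fun n => hdigit (hdesub n)

theorem IsRecognizable.liYorkePairs_eq_empty [Finite A] (hτ : IsRecognizable τ)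
    (hinj : Function.Injective τ) (hp : 2 ≤ p) (hcoinc : ¬ HasCoincidence τ) :
    liYorkePairs (substShift τ) seqDist shift = ∅ := by
  refine Set.eq_empty_of_forall_notMem ?_
  rintro ⟨x, y⟩ ⟨hprox, hasymp⟩
  obtain ⟨hx, hy, hliminf⟩ := id hprox
  have hxy := (eqOnLongIntervals_of_mem_proximalPairs hprox).odometerMap_eq hτ hinj hx hy
  have hdiff : ∃ i : ℤ, x i ≠ y i ∧ (iPlus τ (shiftPow i x)).Infinite :=
    not_not.1 fun h => hasymp (hτ.mem_asymptoticPairs hinj hp hx hy h)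
  obtain ⟨i, hi, hinf⟩ := hdiff
  exact (hτ.mem_distalPairs hinj hcoinc hx hy hxy hi hinf).2.2.ne' hliminf

end LiYorke

end Subst

open Subst in
theorem proposition3p4_general {A : Type*} [Finite A] (p : ℕ) [NeZero p] (hp : 2 ≤ p)
    (τ : A → Fin p → A) (hinj : Function.Injective τ) (hτ : IsRecognizable τ) :
    (∀ x ∈ substShift τ, ∀ y ∈ substShift τ, odometerMap τ x = odometerMap τ y →
      (iPlus τ x = iPlus τ y ∧ kPlus τ x = kPlus τ y) ∧
      ((x, y) ∈ asymptoticPairs (substShift τ) seqDist shift ↔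
        ((iPlus τ x).Infinite ∧ ∀ᶠ i : ℕ in atTop, sWord τ x i = sWord τ y i) ∨
        ((iPlus τ x).Finite ∧ ∀ᶠ i : ℕ in atTop,
          sWord τ (shiftPow (kPlus τ x) x) i = sWord τ (shiftPow (kPlus τ x) y) i)) ∧
      (¬ HasCoincidence τ →
        ((∃ i : ℤ, x i ≠ y i ∧ (iPlus τ (shiftPow i x)).Infinite) →
          (x, y) ∈ distalPairs (substShift τ) seqDist shift) ∧
        ((¬ ∃ i : ℤ, x i ≠ y i ∧ (iPlus τ (shiftPow i x)).Infinite) →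
          (x, y) ∈ asymptoticPairs (substShift τ) seqDist shift))) ∧
    (¬ HasCoincidence τ → liYorkePairs (substShift τ) seqDist shift = ∅) := by
  refine ⟨fun x hx y hy hxy => ⟨⟨iPlus_congr hxy, kPlus_congr hxy⟩,
    hτ.mem_asymptoticPairs_iff hinj hp hx hy hxy, fun hcoinc => ⟨?_, ?_⟩⟩,
    hτ.liYorkePairs_eq_empty hinj hp⟩
  · rintro ⟨i, hi, hinf⟩
    exact hτ.mem_distalPairs hinj hcoinc hx hy hxy hi hinf
  · exact hτ.mem_asymptoticPairs hinj hp hx hy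

theorem proposition3p4 {A : Type*} [Finite A] (p : ℕ) [NeZero p] (hp : 2 ≤ p)
    (τ : A → Fin p → A) (hinj : Function.Injective τ) (hprim : Subst.IsPrimitive τ)
    (hinf : (Subst.substShift τ).Infinite) :
    (∀ x ∈ Subst.substShift τ, ∀ y ∈ Subst.substShift τ,
      Subst.odometerMap τ x = Subst.odometerMap τ y →
      (Subst.iPlus τ x = Subst.iPlus τ y ∧ Subst.kPlus τ x = Subst.kPlus τ y) ∧
      ((x, y) ∈ Subst.asymptoticPairs (Subst.substShift τ) Subst.seqDist Subst.shift ↔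
        ((Subst.iPlus τ x).Infinite ∧
          ∀ᶠ i : ℕ in Filter.atTop, Subst.sWord τ x i = Subst.sWord τ y i) ∨
        ((Subst.iPlus τ x).Finite ∧
          ∀ᶠ i : ℕ in Filter.atTop,
            Subst.sWord τ (Subst.shiftPow (Subst.kPlus τ x) x) i =
              Subst.sWord τ (Subst.shiftPow (Subst.kPlus τ x) y) i)) ∧
      (¬ Subst.HasCoincidence τ →
        ((∃ i : ℤ, x i ≠ y i ∧ (Subst.iPlus τ (Subst.shiftPow i x)).Infinite) →
          (x, y) ∈ Subst.distalPairs (Subst.substShift τ) Subst.seqDist Subst.shift) ∧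
        ((¬ ∃ i : ℤ, x i ≠ y i ∧ (Subst.iPlus τ (Subst.shiftPow i x)).Infinite) →
          (x, y) ∈ Subst.asymptoticPairs (Subst.substShift τ) Subst.seqDist Subst.shift))) ∧
    (¬ Subst.HasCoincidence τ →
      Subst.liYorkePairs (Subst.substShift τ) Subst.seqDist Subst.shift = ∅) := by
  exact proposition3p4_general p hp τ hinj (Subst.isRecognizable hinj hprim hinf)
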